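/- For a sequence $(x_n)$ of real numbers let $\operatorname{A}(x_n)=\{\sum_{n=1}^\infty\varepsilon_nx_n : (\varepsilon_n)\in\{0,1\}^{\mathbb N},\ \sum_{n=1}^\infty\varepsilon_nx_n\text{ converges}\}$. A subset $A$ of a Polish space $X$ is called $\Pi^0_3$-complete if it is $F_{\sigma\delta}$ (a countable intersection of countable unions of closed sets) and for every zero-dimensional Polish space $Y$ and every $F_{\sigma\delta}$ set $B\subseteq Y$ there is a continuous function $f:Y\to X$ with $f^{-1}(A)=B$. Let $\sum_{n=1}^\infty x_n$ be a conditionally convergent series of real numbers (convergent but not absolutely convergent) such that $\operatorname{A}(x_n)=\mathbb R$. Then the set $$E:=\{(\varepsilon_n)\in\{0,1\}^{\mathbb N} : \textstyle\sum_{n=1}^\infty\varepsilon_nx_n\text{ converges}\}$$ is a $\Pi^0_3$-complete subset of the Cantor space $\{0,1\}^{\mathbb N}$ (with the product topology). -/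

import Mathlib

open Filter Topology

universe u

/-- The Cantor space is Polish. -/
instance cantorSpace_polishSpace : PolishSpace (ℕ → Bool) where

/-- The series `∑ xₙ` of reals converges to `s`: its partial sums, taken in the given order,
tend to `s`. -/
def SeriesConvergesTo (x : ℕ → ℝ) (s : ℝ) : Prop :=
  Tendsto (fun N : ℕ => ∑ n ∈ Finset.range N, x n) atTop (𝓝 s)

/-- The series `∑ xₙ` of reals converges. -/
def SeriesConverges (x : ℕ → ℝ) : Prop :=
  ∃ s : ℝ, SeriesConvergesTo x s

/-- The series `∑ xₙ` of reals is conditionally convergent: it converges, but not absolutely. -/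
def ConditionallyConvergent (x : ℕ → ℝ) : Prop :=
  SeriesConverges x ∧ ¬ SeriesConverges (fun n => |x n|)

/-- The sequence `(εₙ xₙ)` for a 0-1 sequence `ε`, a point of the Cantor space `ℕ → Bool`. -/
def subseries (x : ℕ → ℝ) (ε : ℕ → Bool) : ℕ → ℝ :=
  fun n => if ε n = true then x n else 0

/-- The achievement set `A(xₙ)`: the set of sums of all convergent series `∑ εₙ xₙ`. -/
def achievementSet (x : ℕ → ℝ) : Set ℝ :=
  {s | ∃ ε : ℕ → Bool, SeriesConvergesTo (subseries x ε) s}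

/-- The set `E` of all 0-1 sequences `ε` such that `∑ εₙ xₙ` converges. -/
def convergenceSet (x : ℕ → ℝ) : Set (ℕ → Bool) :=
  {ε | SeriesConverges (subseries x ε)}

/-- `F_σδ` sets: countable intersections of countable unions of closed sets. -/
def IsFSigmaDelta {X : Type*} [TopologicalSpace X] (A : Set X) : Prop :=
  ∃ F : ℕ → ℕ → Set X, (∀ i j, IsClosed (F i j)) ∧ A = ⋂ i, ⋃ j, F i j

/-- A topological space is zero-dimensional if it is Hausdorff and its clopen sets form a basis. -/
def IsZeroDimensional (Y : Type*) [TopologicalSpace Y] : Prop :=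
  T2Space Y ∧ TopologicalSpace.IsTopologicalBasis {s : Set Y | IsClopen s}

/-- A subset `A` of a Polish space `X` is `Π⁰₃`-complete if it is `F_σδ` and every `F_σδ` subset
of every zero-dimensional Polish space is the preimage of `A` under some continuous function. -/
def IsPi03Complete {X : Type*} [TopologicalSpace X] [PolishSpace X] (A : Set X) : Prop :=
  IsFSigmaDelta A ∧
    ∀ (Y : Type u) [TopologicalSpace Y] [PolishSpace Y], IsZeroDimensional Y →
      ∀ B : Set Y, IsFSigmaDelta B → ∃ f : Y → X, Continuous f ∧ f ⁻¹' A = B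

/-! The Cauchy criterion makes `E` an `F_σδ` set. For hardness, an `F_σδ` set `B` is coded by clopen
events `C i n` such that `y ∈ B` iff `y` lies in finitely many events of each row `i`
(`IsFSigmaDelta.exists_isClopen_finite`). The terms tend to 0 while their positive and negative
parts have infinite sums, so each pair `p = (i, n)` can be given a finite block `F p` in its own
window, whose partial sums climb to about `1 / (i + 1)` and end within `(1 / 2) ^ p` of 0
(`ConditionallyConvergent.exists_seq_oscillation`).

The reduction sends `y` to the union of the blocks `F p` with `y ∈ C i n`. The net contributions of
the blocks are summable, so divergence occurs exactly when some height `1 / (i + 1)` recurs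
infinitely often (`seriesConverges_blocks_iff`). -/

theorem seriesConverges_iff_cauchySeq {x : ℕ → ℝ} :
    SeriesConverges x ↔ CauchySeq fun N : ℕ => ∑ n ∈ Finset.range N, x n :=
  ⟨fun ⟨_, hs⟩ => hs.cauchySeq, fun h => cauchySeq_tendsto_of_complete h⟩

/-- The set of `ε` for which `∑ εₙ xₙ` converges is `F_σδ`, by the Cauchy criterion. -/
theorem isFSigmaDelta_convergenceSet (x : ℕ → ℝ) : IsFSigmaDelta (convergenceSet x) := by
  refine ⟨fun i j => {ε | ∀ m ≥ j, dist (∑ n ∈ Finset.range m, subseries x ε n)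
    (∑ n ∈ Finset.range j, subseries x ε n) ≤ 1 / ((i : ℝ) + 1)}, fun i j => ?_, ?_⟩
  · have hc : ∀ m, Continuous fun ε : ℕ → Bool => ∑ n ∈ Finset.range m, subseries x ε n := by
      intro m
      refine continuous_finsetSum _ fun n _ => ?_
      exact (continuous_of_discreteTopology (f := fun b : Bool => if b = true then x n else 0)).comp
        (continuous_apply n)
    simp only [Set.ofPred_forall]
    exact isClosed_iInter fun m => isClosed_iInter fun _ =>
      isClosed_le ((hc m).dist (hc j)) continuous_const
  · ext ε
    simp only [convergenceSet, Set.mem_ofPred_eq, seriesConverges_iff_cauchySeq, Set.mem_iInter,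
      Set.mem_iUnion, Metric.cauchySeq_iff']
    constructor
    · intro h i
      obtain ⟨N, hN⟩ := h (1 / ((i : ℝ) + 1)) Nat.one_div_pos_of_nat
      exact ⟨N, fun m hm => (hN m hm).le⟩
    · intro h δ hδ
      obtain ⟨i, hi⟩ := exists_nat_one_div_lt hδ
      obtain ⟨j, hj⟩ := h i
      exact ⟨j, fun m hm => (hj m hm).trans_lt hi⟩

/-! ### Coding `F_σδ` sets by clopen matrices. -/

/-- In a second countable zero-dimensional space, every open set is a countable disjoint union of
clopen sets. -/
theorem exists_disjoint_isClopen_iUnion {Y : Type*} [TopologicalSpace Y]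
    [SecondCountableTopology Y] (hY : IsZeroDimensional Y) {U : Set Y} (hU : IsOpen U) :
    ∃ V : ℕ → Set Y, (∀ n, IsClopen (V n)) ∧ Pairwise (Function.onFun Disjoint V) ∧
      ⋃ n, V n = U := by
  obtain ⟨S, hS, rfl⟩ := hY.2.open_eq_sUnion hU
  obtain ⟨T, hT, hTS, hTU⟩ := TopologicalSpace.isOpen_sUnion_countable S fun s hs => (hS hs).2
  obtain ⟨V, hV⟩ := (hT.insert ∅).exists_eq_range (Set.insert_nonempty _ _)
  have hclopen : ∀ n, IsClopen (V n) := by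
    intro n
    have hn : V n ∈ insert ∅ T := hV ▸ Set.mem_range_self n
    rcases hn with hn | hn
    · rw [hn]; exact isClopen_empty
    · exact hS (hTS hn)
  refine ⟨disjointed V, fun n => ?_, disjoint_disjointed V, ?_⟩
  · exact disjointedRec (fun {t i} ht => ht.diff (hclopen i)) (hclopen n)
  · rw [iUnion_disjointed, ← Set.sUnion_range, ← hV, Set.sUnion_insert, Set.empty_union, hTU]

/-- Membership in an `F_σδ` set is the finiteness of each row of a matrix of clopen events. -/
theorem IsFSigmaDelta.exists_isClopen_finite {Y : Type*} [TopologicalSpace Y]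
    [SecondCountableTopology Y] (hY : IsZeroDimensional Y) {B : Set Y} (hB : IsFSigmaDelta B) :
    ∃ C : ℕ → ℕ → Set Y, (∀ i n, IsClopen (C i n)) ∧
      ∀ y, y ∈ B ↔ ∀ i, {n | y ∈ C i n}.Finite := by
  obtain ⟨F, hF, rfl⟩ := hB
  -- These open sets decrease in `j`, so a point lies in `⋃ k, F i k` iff it lies in only finitely
  -- many of them. Cutting each into disjoint clopen pieces makes every `j` contribute at most one
  -- event at `y`.
  have hU : ∀ i j, IsOpen (⋂ k ∈ Finset.range (j + 1), (F i k)ᶜ) := fun i j =>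
    isOpen_biInter_finset fun k _ => (hF i k).isOpen_compl
  choose V hV hdisj hunion using fun i j => exists_disjoint_isClopen_iUnion hY (hU i j)
  refine ⟨fun i n => V i n.unpair.1 n.unpair.2, fun i n => hV _ _ _, fun y => ?_⟩
  simp only [Set.mem_iInter, Set.mem_iUnion]
  refine forall_congr' fun i => ?_
  have hmem : ∀ j, (∃ n, y ∈ V i j n) ↔ ∀ k ≤ j, y ∉ F i k := by
    intro j
    rw [← Set.mem_iUnion, hunion]
    simp
  constructor
  · rintro ⟨j, hj⟩
    refine Set.Finite.of_finite_image (f := fun n : ℕ => n.unpair.1) ?_ ?_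
    · refine (Set.finite_Iio j).subset ?_
      rintro _ ⟨n, hn, rfl⟩
      by_contra hlt
      exact (hmem _).1 ⟨_, hn⟩ j (not_lt.1 hlt) hj
    · intro n hn m hm hnm
      simp only [Set.mem_ofPred_eq] at hn hm hnm
      rw [← hnm] at hm
      have h2 : n.unpair.2 = m.unpair.2 := by
        by_contra hne
        exact Set.disjoint_left.1 (hdisj i _ hne) hn hm
      rw [← Nat.pair_unpair n, ← Nat.pair_unpair m, hnm, h2]
  · intro hfin
    by_contra! hy
    choose n hn using fun j => (hmem j).2 fun k _ => hy k
    refine Set.infinite_of_injective_forall_mem (f := fun j => Nat.pair j (n j)) ?_ ?_ hfin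
    · intro j k hjk
      exact (Nat.pair_eq_pair.1 hjk).1
    · intro j
      simpa using hn j

/-! ### Oscillating blocks of terms. -/

theorem SeriesConverges.tendsto_zero {x : ℕ → ℝ} (hx : SeriesConverges x) :
    Tendsto x atTop (𝓝 0) := by
  obtain ⟨s, hs⟩ := hx
  have h := ((tendsto_add_atTop_iff_nat 1).2 hs).sub hs
  simpa [Finset.sum_range_succ] using h

/-- The positive parts of the terms of a conditionally convergent series have infinite sum. -/
theorem ConditionallyConvergent.tendsto_sum_max {x : ℕ → ℝ} (hx : ConditionallyConvergent x) :
    Tendsto (fun N : ℕ => ∑ n ∈ Finset.range N, max (x n) 0) atTop atTop := by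
  obtain ⟨⟨s, hs⟩, habs⟩ := hx
  have h1 : Tendsto (fun N : ℕ => ∑ n ∈ Finset.range N, |x n|) atTop atTop :=
    (not_summable_iff_tendsto_nat_atTop_of_nonneg fun n => abs_nonneg (x n)).1
      fun h => habs ⟨_, h.hasSum.tendsto_sum_nat⟩
  -- `max (x n) 0 = (|x n| + x n) / 2`.
  have h2 := (h1.atTop_add hs).const_mul_atTop (r := 1 / 2) (by norm_num)
  refine h2.congr fun N => ?_
  rw [← Finset.sum_add_distrib, Finset.mul_sum]
  refine Finset.sum_congr rfl fun n _ => ?_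
  rcases le_total 0 (x n) with h | h
  · rw [abs_of_nonneg h, max_eq_left h]; ring
  · rw [abs_of_nonpos h, max_eq_right h]; ring

theorem ConditionallyConvergent.neg {x : ℕ → ℝ} (hx : ConditionallyConvergent x) :
    ConditionallyConvergent fun n => -x n := by
  obtain ⟨⟨s, hs⟩, habs⟩ := hx
  refine ⟨⟨-s, ?_⟩, by simpa using habs⟩
  simpa [SeriesConvergesTo] using Filter.Tendsto.neg hs

/-- Consecutive sums of small terms with infinite total overshoot a target only by little. -/
theorem exists_sum_Ico_mem_Ico {u : ℕ → ℝ}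
    (hu : Tendsto (fun N : ℕ => ∑ n ∈ Finset.range N, u n) atTop atTop) {a : ℕ} {t δ : ℝ}
    (ht : 0 ≤ t) (hδ : ∀ n ≥ a, u n < δ) (hpos : 0 < δ) :
    ∃ c ≥ a, t ≤ ∑ n ∈ Finset.Ico a c, u n ∧ ∑ n ∈ Finset.Ico a c, u n < t + δ := by
  classical
  have hex : ∃ c, a ≤ c ∧ t ≤ ∑ n ∈ Finset.Ico a c, u n := by
    obtain ⟨c, hc, hac⟩ := ((hu.eventually_ge_atTop (t + ∑ n ∈ Finset.range a, u n)).and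
      (eventually_ge_atTop a)).exists
    refine ⟨c, hac, ?_⟩
    rw [Finset.sum_Ico_eq_sub _ hac]
    linarith
  obtain ⟨hac, htc⟩ := Nat.find_spec hex
  refine ⟨Nat.find hex, hac, htc, ?_⟩
  rcases hac.eq_or_lt with h | h
  · rw [← h]; simp; linarith
  · obtain ⟨d, hd⟩ := Nat.exists_eq_succ_of_ne_zero (Nat.ne_zero_of_lt h)
    have hmin := Nat.find_min hex (m := d) (by omega)
    have had : a ≤ d := by omega
    rw [hd, Nat.succ_eq_add_one, Finset.sum_Ico_succ_top had]
    have := hδ d had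
    have : ∑ n ∈ Finset.Ico a d, u n < t := by
      by_contra hlt
      exact hmin ⟨had, not_lt.1 hlt⟩
    linarith

/-- Far out in a conditionally convergent series there are finite blocks of terms whose partial sums
rise to about `t` and return to about `0`. -/
theorem ConditionallyConvergent.exists_oscillation {x : ℕ → ℝ} (hx : ConditionallyConvergent x)
    (a : ℕ) {t δ : ℝ} (ht : 0 ≤ t) (hδ : 0 < δ) :
    ∃ F : Finset ℕ, (∀ k ∈ F, a ≤ k) ∧ (∀ N, |∑ k ∈ F with k < N, x k| ≤ t + δ) ∧
      (∃ N, t ≤ ∑ k ∈ F with k < N, x k) ∧ |∑ k ∈ F, x k| ≤ δ := by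
  obtain ⟨b, hb⟩ := eventually_atTop.1 (hx.1.tendsto_zero.eventually (Metric.ball_mem_nhds 0 hδ))
  have hsmall : ∀ n ≥ max a b, |x n| < δ := fun n hn => by
    simpa using hb n (le_of_max_le_right hn)
  obtain ⟨c, hac, hP, hP'⟩ := exists_sum_Ico_mem_Ico hx.tendsto_sum_max ht
    (fun n hn => max_lt ((le_abs_self _).trans_lt (hsmall n hn)) hδ) hδ
  obtain ⟨m, hcm, hQ, hQ'⟩ := exists_sum_Ico_mem_Ico hx.neg.tendsto_sum_max (ht.trans hP)
    (fun n hn => max_lt ((neg_le_abs _).trans_lt (hsmall n (hac.trans hn))) hδ) hδ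
  set P := ∑ n ∈ Finset.Ico (max a b) c, max (x n) 0 with hPdef
  set Q := ∑ n ∈ Finset.Ico c m, max (-x n) 0 with hQdef
  let F := {k ∈ Finset.Ico (max a b) c | 0 < x k} ∪ {k ∈ Finset.Ico c m | x k < 0}
  have hsum : ∀ N, ∑ k ∈ F with k < N, x k =
      ∑ k ∈ Finset.Ico (max a b) c with k < N, max (x k) 0 -
        ∑ k ∈ Finset.Ico c m with k < N, max (-x k) 0 := by
    intro N
    rw [Finset.filter_union, Finset.sum_union, sub_eq_add_neg, ← Finset.sum_neg_distrib]
    · simp only [Finset.sum_filter]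
      congr 1 <;> refine Finset.sum_congr rfl fun k _ => ?_ <;>
        rcases lt_trichotomy (x k) 0 with h | h | h <;>
        simp [h, h.le, h.not_gt]
    · rw [Finset.disjoint_left]
      simp only [Finset.mem_filter, Finset.mem_Ico]
      intro k hk hk'
      omega
  have hfst : ∀ N, c ≤ N → ∑ k ∈ Finset.Ico (max a b) c with k < N, max (x k) 0 = P := by
    intro N hN
    rw [Finset.filter_true_of_mem]
    intro k hk
    exact (Finset.mem_Ico.1 hk).2.trans_le hN
  have hsnd : ∀ N, N ≤ c → ∑ k ∈ Finset.Ico c m with k < N, max (-x k) 0 = 0 := by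
    intro N hN
    rw [Finset.filter_false_of_mem, Finset.sum_empty]
    intro k hk
    exact not_lt.2 (hN.trans (Finset.mem_Ico.1 hk).1)
  have hfst_nonneg : ∀ N, 0 ≤ ∑ k ∈ Finset.Ico (max a b) c with k < N, max (x k) 0 :=
    fun N => Finset.sum_nonneg fun k _ => le_max_right _ _
  have hsnd_nonneg : ∀ N, 0 ≤ ∑ k ∈ Finset.Ico c m with k < N, max (-x k) 0 :=
    fun N => Finset.sum_nonneg fun k _ => le_max_right _ _
  have hfst_le : ∀ N, ∑ k ∈ Finset.Ico (max a b) c with k < N, max (x k) 0 ≤ P :=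
    fun N => Finset.sum_le_sum_of_subset_of_nonneg (Finset.filter_subset _ _)
      fun k _ _ => le_max_right _ _
  have hsnd_le : ∀ N, ∑ k ∈ Finset.Ico c m with k < N, max (-x k) 0 ≤ Q :=
    fun N => Finset.sum_le_sum_of_subset_of_nonneg (Finset.filter_subset _ _)
      fun k _ _ => le_max_right _ _
  refine ⟨F, fun k hk => ?_, fun N => ?_, ⟨c, ?_⟩, ?_⟩
  · simp only [F, Finset.mem_union, Finset.mem_filter, Finset.mem_Ico] at hk
    omega
  · have h1 := hfst_nonneg N
    have h2 := hsnd_nonneg N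
    have h3 := hfst_le N
    have h4 := hsnd_le N
    rw [hsum, abs_le]
    rcases le_total N c with h | h
    · rw [hsnd N h]; constructor <;> linarith
    · rw [hfst N h]; constructor <;> linarith
  · rw [hsum, hfst c le_rfl, hsnd c le_rfl, sub_zero]
    exact hP
  · have hF : {k ∈ F | k < m} = F := by
      rw [Finset.filter_true_of_mem]
      intro k hk
      simp only [F, Finset.mem_union, Finset.mem_filter, Finset.mem_Ico] at hk
      omega
    have hm : {k ∈ Finset.Ico c m | k < m} = Finset.Ico c m :=
      Finset.filter_true_of_mem fun k hk => (Finset.mem_Ico.1 hk).2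
    rw [← hF, hsum, hfst m hcm, hm, ← hQdef, abs_le]
    constructor <;> linarith

/-- Successive oscillations of prescribed heights, in disjoint consecutive windows. -/
theorem ConditionallyConvergent.exists_seq_oscillation {x : ℕ → ℝ}
    (hx : ConditionallyConvergent x) {t δ : ℕ → ℝ} (ht : ∀ p, 0 ≤ t p) (hδ : ∀ p, 0 < δ p) :
    ∃ (a : ℕ → ℕ) (F : ℕ → Finset ℕ), a 0 = 0 ∧ StrictMono a ∧
      (∀ p, F p ⊆ Finset.Ico (a p) (a (p + 1))) ∧
      (∀ p N, |∑ k ∈ F p with k < N, x k| ≤ t p + δ p) ∧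
      (∀ p, ∃ N, t p ≤ ∑ k ∈ F p with k < N, x k) ∧ ∀ p, |∑ k ∈ F p, x k| ≤ δ p := by
  choose G hG h1 h2 h3 using fun p a => hx.exists_oscillation a (ht p) (hδ p)
  let a : ℕ → ℕ := fun p => Nat.rec 0 (fun p b => max b ((G p b).sup id) + 1) p
  have ha : ∀ p, a (p + 1) = max (a p) ((G p (a p)).sup id) + 1 := fun _ => rfl
  refine ⟨a, fun p => G p (a p), rfl, strictMono_nat_of_lt_succ fun p => ?_, fun p k hk => ?_,
    fun p => h1 _ _, fun p => h2 _ _, fun p => h3 _ _⟩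
  · rw [ha]; omega
  · have hle : k ≤ (G p (a p)).sup id := Finset.le_sup (f := id) hk
    rw [Finset.mem_Ico, ha]
    exact ⟨hG _ _ _ hk, by omega⟩

/-! ### Convergence of block series and the reduction. -/

theorem exists_mem_window {a : ℕ → ℕ} (h0 : a 0 = 0) (ha : StrictMono a) (N : ℕ) :
    ∃ p, a p ≤ N ∧ N < a (p + 1) := by
  classical
  have hex : ∃ q, N < a q := ⟨N + 1, (Nat.lt_succ_self N).trans_le (ha.id_le _)⟩
  have hspec := Nat.find_spec hex
  obtain ⟨p, hp⟩ := Nat.exists_eq_succ_of_ne_zero (n := Nat.find hex) fun h => by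
    rw [h, h0] at hspec; omega
  rw [hp] at hspec
  exact ⟨p, not_lt.1 (Nat.find_min hex (m := p) (by omega)), hspec⟩

/-- The series obtained by switching on the blocks `F p` with `p ∈ D` converges if and only if, for
every `i`, only finitely many oscillations of height `1 / (i + 1)` are switched on. -/
theorem seriesConverges_blocks_iff {x : ℕ → ℝ} {a : ℕ → ℕ} {F : ℕ → Finset ℕ} (h0 : a 0 = 0)
    (ha : StrictMono a) (hF : ∀ p, F p ⊆ Finset.Ico (a p) (a (p + 1)))
    (h1 : ∀ p N, |∑ k ∈ F p with k < N, x k| ≤ 1 / ((p.unpair.1 : ℝ) + 1) + (1 / 2) ^ p)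
    (h2 : ∀ p, ∃ N, 1 / ((p.unpair.1 : ℝ) + 1) ≤ ∑ k ∈ F p with k < N, x k)
    (h3 : ∀ p, |∑ k ∈ F p, x k| ≤ (1 / 2) ^ p) {ε : ℕ → Bool} {D : Set ℕ}
    (hε : ∀ k, ε k = true ↔ ∃ p ∈ D, k ∈ F p) :
    SeriesConverges (subseries x ε) ↔ ∀ i, {n | Nat.pair i n ∈ D}.Finite := by
  classical
  set S : ℕ → ℝ := fun N => ∑ k ∈ Finset.range N, subseries x ε k with hS
  have hwindow : ∀ p k, a p ≤ k → k < a (p + 1) → (ε k = true ↔ p ∈ D ∧ k ∈ F p) := by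
    intro p k hpk hkp
    rw [hε]
    constructor
    · rintro ⟨q, hq, hk⟩
      have hqk := Finset.mem_Ico.1 (hF q hk)
      have hqp : q < p + 1 := ha.lt_iff_lt.1 (hqk.1.trans_lt hkp)
      have hpq : p < q + 1 := ha.lt_iff_lt.1 (hpk.trans_lt hqk.2)
      obtain rfl : q = p := by omega
      exact ⟨hq, hk⟩
    · rintro ⟨hp, hk⟩
      exact ⟨p, hp, hk⟩
  have hdiff : ∀ p N, a p ≤ N → N ≤ a (p + 1) →
      S N - S (a p) = if p ∈ D then ∑ k ∈ F p with k < N, x k else 0 := by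
    intro p N hpN hNp
    have hcongr : ∑ k ∈ Finset.Ico (a p) N, subseries x ε k =
        ∑ k ∈ Finset.Ico (a p) N, if p ∈ D ∧ k ∈ F p then x k else 0 := by
      refine Finset.sum_congr rfl fun k hk => ?_
      rw [Finset.mem_Ico] at hk
      simp only [subseries, hwindow p k hk.1 (hk.2.trans_le hNp)]
    rw [hS, ← Finset.sum_Ico_eq_sub _ hpN, hcongr, ← Finset.sum_filter]
    split_ifs with hp
    · congr 1
      ext k
      have := @hF p k
      simp only [Finset.mem_filter, Finset.mem_Ico] at this ⊢
      tauto
    · simp [hp]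
  have hdiff_succ : ∀ p, dist (S (a p)) (S (a (p + 1))) ≤ 1 * (1 / 2) ^ p := by
    intro p
    rw [dist_comm, Real.dist_eq, hdiff p _ (ha (Nat.lt_succ_self p)).le le_rfl, one_mul]
    split_ifs
    · rw [Finset.filter_true_of_mem fun k hk => (Finset.mem_Ico.1 (hF p hk)).2]
      exact h3 p
    · simp
  constructor
  · intro hconv i
    by_contra hinf
    rw [seriesConverges_iff_cauchySeq, Metric.cauchySeq_iff] at hconv
    obtain ⟨M, hM⟩ := hconv (1 / ((i : ℝ) + 1)) Nat.one_div_pos_of_nat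
    obtain ⟨n, hn, hMn⟩ := Set.Infinite.exists_gt hinf M
    have hMa : M ≤ a (Nat.pair i n) :=
      hMn.le.trans ((Nat.right_le_pair i n).trans (ha.id_le _))
    obtain ⟨N, hN⟩ := h2 (Nat.pair i n)
    simp only [Nat.unpair_pair] at hN
    have hpos : (0 : ℝ) < 1 / ((i : ℝ) + 1) := Nat.one_div_pos_of_nat
    set p := Nat.pair i n
    have hpN : a p ≤ N := by
      by_contra hlt
      rw [Finset.filter_false_of_mem, Finset.sum_empty] at hN
      · linarith
      · intro k hk
        have := Finset.mem_Ico.1 (hF p hk)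
        omega
    -- Cutting `N` off at the end of the window loses no term of `F p`, and `hdiff` then applies.
    have hmin : ∑ k ∈ F p with k < N, x k = ∑ k ∈ F p with k < min N (a (p + 1)), x k := by
      congr 1
      refine Finset.filter_congr fun k hk => ?_
      have := Finset.mem_Ico.1 (hF p hk)
      omega
    have hle : a p ≤ min N (a (p + 1)) := le_min hpN (ha (Nat.lt_succ_self p)).le
    have hd := hdiff p _ hle (min_le_right _ _)
    rw [if_pos (show p ∈ D from hn), ← hmin] at hd
    have hlt := hM _ (hMa.trans hle) _ hMa
    rw [Real.dist_eq] at hlt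
    have := (le_abs_self _).trans_lt hlt
    change S _ - S _ < _ at this
    linarith
  · intro hfin
    obtain ⟨s, hs⟩ := cauchySeq_tendsto_of_complete
      (cauchySeq_of_le_geometric (1 / 2) 1 (by norm_num) hdiff_succ)
    refine ⟨s, Metric.tendsto_atTop.2 fun η hη => ?_⟩
    obtain ⟨i, hi⟩ := exists_nat_one_div_lt (show 0 < η / 3 by positivity)
    have hfar : ∀ᶠ p in atTop, p ∈ D → i ≤ p.unpair.1 := by
      -- Only finitely many switched-on blocks come from rows `j < i`; past them every oscillation
      -- has height at most `1 / (i + 1)`.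
      have hfinite : (⋃ j ∈ Set.Iio i, Nat.pair j '' {n | Nat.pair j n ∈ D}).Finite :=
        (Set.finite_Iio i).biUnion fun j _ => (hfin j).image _
      rw [← Nat.cofinite_eq_atTop]
      filter_upwards [hfinite.compl_mem_cofinite] with p hp hpD
      by_contra hlt
      refine hp (Set.mem_biUnion (not_le.1 hlt) ⟨p.unpair.2, ?_, Nat.pair_unpair p⟩)
      simpa using hpD
    have hgeom : ∀ᶠ p : ℕ in atTop, (1 / 2 : ℝ) ^ p < η / 3 :=
      (tendsto_pow_atTop_nhds_zero_of_lt_one (by norm_num) (by norm_num)).eventually_lt_const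
        (by positivity)
    have hlim : ∀ᶠ p in atTop, dist (S (a p)) s < η / 3 :=
      hs.eventually (Metric.ball_mem_nhds s (by positivity))
    obtain ⟨P, hP⟩ := eventually_atTop.1 (hfar.and (hgeom.and hlim))
    refine ⟨a P, fun N hN => ?_⟩
    obtain ⟨p, hpN, hNp⟩ := exists_mem_window h0 ha N
    have hPp : P < p + 1 := ha.lt_iff_lt.1 (hN.trans_lt hNp)
    obtain ⟨hp1, hp2, hp3⟩ := hP p (Nat.lt_succ_iff.1 hPp)
    have hdist : dist (S N) (S (a p)) < η / 3 + η / 3 := by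
      rw [Real.dist_eq, hdiff p N hpN hNp.le]
      split_ifs with hp
      · have hle : 1 / ((p.unpair.1 : ℝ) + 1) ≤ 1 / ((i : ℝ) + 1) :=
          Nat.one_div_le_one_div (hp1 hp)
        linarith [h1 p N]
      · rw [abs_zero]; positivity
    have := dist_triangle (S N) (S (a p)) s
    change dist (S N) s < η
    linarith

theorem mainTheorem6 (x : ℕ → ℝ) (hx : ConditionallyConvergent x)
    (hA : achievementSet x = Set.univ) :
    IsPi03Complete.{u} (convergenceSet x) := by
  classical
  refine ⟨isFSigmaDelta_convergenceSet x, fun Y _ _ hY B hB => ?_⟩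
  obtain ⟨C, hC, hBC⟩ := hB.exists_isClopen_finite hY
  obtain ⟨a, F, h0, ha, hF, h1, h2, h3⟩ := hx.exists_seq_oscillation
    (t := fun p => 1 / ((p.unpair.1 : ℝ) + 1)) (δ := fun p => (1 / 2) ^ p)
    (fun p => Nat.one_div_pos_of_nat.le) (fun p => by positivity)
  let D : Y → Set ℕ := fun y => {p | y ∈ C p.unpair.1 p.unpair.2}
  refine ⟨fun y k => decide (∃ p ∈ D y, k ∈ F p), continuous_pi fun k => ?_, ?_⟩
  · refine (continuous_bool_rng true).2 ?_
    -- As `p ≤ a p`, only blocks with `p ≤ k` can contain `k`; a finite union of clopen sets thus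
    -- decides coordinate `k`.
    have hset : (fun y => decide (∃ p ∈ D y, k ∈ F p)) ⁻¹' {true} =
        ⋃ p ∈ {p ∈ Finset.range (k + 1) | k ∈ F p}, C p.unpair.1 p.unpair.2 := by
      ext y
      simp only [Set.mem_preimage, Set.mem_singleton_iff, decide_eq_true_eq, Set.mem_iUnion,
        Finset.mem_filter, Finset.mem_range, exists_prop, D, Set.mem_ofPred_eq]
      refine exists_congr fun p => ⟨fun ⟨hp, hk⟩ => ⟨⟨?_, hk⟩, hp⟩, fun h => ⟨h.2, h.1.2⟩⟩
      exact Nat.lt_succ_iff.2 ((ha.id_le p).trans (Finset.mem_Ico.1 (hF p hk)).1)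
    rw [hset]
    exact isClopen_biUnion_finset fun p _ => hC _ _
  · ext y
    rw [Set.mem_preimage, hBC]
    refine (seriesConverges_blocks_iff (D := D y) h0 ha hF h1 h2 h3 fun k => ?_).trans ?_
    · simp
    · simp [D]
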